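/- A linear switching system with guards (GLSw-system) $\mathcal H$ consists of: a finite nonempty set of locations $Q=\{1,\dots,N\}$; for each $i\in Q$ a linear control system $S(i)$: $\dot x=A_ix+B_iu$, $y=C_ix$, with $x\in\mathbb R^{n_i}$, $u\in\mathbb R^m$, $y\in\mathbb R^l$; a set $E\subseteq Q\times Q$ of admissible transitions; and, for each $e=(i,h)\in E$, a guard $G(e)\subseteq\mathbb R^{n_i}$ and a reset matrix $R(e)\in\mathbb R^{n_h\times n_i}$, with $R(e)\neq I$ if $i=h$. Let $\mathcal U$ and $\mathcal Y$ be the sets of piecewise continuous functions $\mathbb R\to\mathbb R^m$ and $\mathbb R\to\mathbb R^l$ (locally finitely many discontinuities, with one-sided limits everywhere). Fix an initial time $t_0\in\mathbb R$. An execution with input $u\in\mathcal U$ is given by a finite or infinite sequence of $L\in\{1,2,\dots,\infty\}$ intervals $I_j=[t_j,t_{j+1})$, $0\le j<L$, with $t_j<t_{j+1}$, $t_L=\infty$ if $L<\infty$, and only finitely many switching times $t_j$ in each bounded interval, together with a hybrid state $\xi(t)=(q(t),x(t))$, $x(t)\in\mathbb R^{n_{q(t)}}$, and an output $y\in\mathcal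 Y$, such that on each $I_j$ the location $q$ is constant, $x$ solves $S(q(t_j))$ with input $u$, and $y(t)=C_{q(t_j)}x(t)$, and such that for $1\le j<L$, with $e=(q(t_{j-1}),q(t_j))$ and $x^-(t_j)=\lim_{t\to t_j^-}x(t)$, one has $e\in E$, $x^-(t_j)\in G(e)$ and $x(t_j)=R(e)x^-(t_j)$. $\mathcal H$ is *location observable for the input* $\hat u\in\mathcal U$ if there is a function $\hat q$ with values in $Q$ such that for every $\rho>0$ there is $\hat t>t_0$ such that, for every execution with initial time $t_0$, input $\hat u$ and initial continuous state of Euclidean norm at most $\rho$, $$\hat q\bigl(y|_{[t_0,t]},\hat u|_{[t_0,t)}\bigr)=q(t)\qquad\text{for all } t\ge\hat t \text{ that are not switching times } t_j,\ 0\le j<L .$$ $\mathcal H$ is *location observable* if it is location observable for some $\hat u\in\mathcal U$. For $i\ne h$ put $A_{ih}=\begin{pmatrix}A_i&0\\0&A_h\end{pmatrix}$, $B_{ih}=\begin{pmatrix}B_i\\B_h\end{pmatrix}$, $C_{ih}=\begin{pmatrix}C_i&-C_h\end{pmatrix}$, and let $\mathcal V_{ih}$ be the largest subspace $F$ with $A_{ih}F\subseteq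 F+\operatorname{Im}B_{ih}$ and $F\subseteq\ker C_{ih}$. For $s\in\mathbb R$ let $\mathcal U_{ih}(s)$ be the set of $w\in\mathcal U$ such that $w(t)=Kz(t)+v(t)$ for all $t\ge s$, for some matrix $K$ with $(A_{ih}+B_{ih}K)\mathcal V_{ih}\subseteq\mathcal V_{ih}$, some $v$ with $B_{ih}v(t)\in\mathcal V_{ih}$ for all $t\ge s$, and some solution $z$ of $\dot z=A_{ih}z+B_{ih}w$ on $[s,\infty)$ with $z(s)\in\mathcal V_{ih}$. Let $\mathcal U^*$ be the set of all $u\in\mathcal U$ such that, for all $i\neq h$, all $s\in\mathbb R$ and all $w\in\mathcal U_{ih}(s)$, $u$ and $w$ do not coincide on any interval $[a,b]$ with $s\le a<b$. **Theorem.** $\mathcal H$ is location observable if and only if $$\forall i,h\in Q,\ i\ne h,\ \exists k\in\mathbb N,\ k<n_i+n_h:\quad C_iA_i^kB_i\neq C_hA_h^kB_h. \tag{T}$$ Moreover, if (T) holds then $\mathcal U^*\neq\varnothing$, and $\mathcal H$ is location observable for every input $u\in\mathcal U^*$. -/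

import Mathlib

open Set Filter Topology Matrix

/-- A piecewise continuous function of time: its discontinuities are finitely many in every
bounded interval, and both one-sided limits exist at every instant. -/
def PiecewiseContinuous {E : Type*} [TopologicalSpace E] (f : ℝ → E) : Prop :=
  (∃ D : Set ℝ, (∀ a b : ℝ, (D ∩ Icc a b).Finite) ∧ ∀ t ∉ D, ContinuousAt f t) ∧
    ∀ t : ℝ, (∃ y, Tendsto f (𝓝[<] t) (𝓝 y)) ∧ ∃ y, Tendsto f (𝓝[>] t) (𝓝 y)

/-- The linear control system `x' = A x + B u`, `y = C x`, with state, input and output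
coordinates indexed by `σ`, `ι`, `κ`. -/
structure LinearControlSystem (σ ι κ : Type*) where
  A : Matrix σ σ ℝ
  B : Matrix σ ι ℝ
  C : Matrix κ σ ℝ

namespace LinearControlSystem

variable {σ ι κ : Type*} [Fintype σ] [Fintype ι]

/-- `x` solves `x' = A x + B u` on the interval `I`, for a piecewise continuous input `u`:
it is continuous on `I`, and the equation holds wherever `u` is continuous. -/
def IsTrajectory (S : LinearControlSystem σ ι κ) (u : ℝ → ι → ℝ) (I : Set ℝ)
    (x : ℝ → σ → ℝ) : Prop :=
  ContinuousOn x I ∧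
    ∀ t ∈ interior I, ContinuousAt u t → HasDerivAt x (S.A *ᵥ x t + S.B *ᵥ u t) t

/-- `F` is controlled invariant and contained in the kernel of the output map:
`A F ⊆ F + Im B` and `F ⊆ ker C`. -/
def IsOutputNulling (S : LinearControlSystem σ ι κ) (F : Submodule ℝ (σ → ℝ)) : Prop :=
  F.map S.A.mulVecLin ≤ F ⊔ LinearMap.range S.B.mulVecLin ∧ F ≤ LinearMap.ker S.C.mulVecLin

/-- The maximal controlled invariant subspace contained in `ker C`. -/
def maxControlledInvariant (S : LinearControlSystem σ ι κ) : Submodule ℝ (σ → ℝ) :=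
  sSup {F | S.IsOutputNulling F}

/-- The supremum in the definition of the maximal subspace is attained. -/
theorem isGreatest_maxControlledInvariant (S : LinearControlSystem σ ι κ) :
    IsGreatest {F | S.IsOutputNulling F} S.maxControlledInvariant := by
  refine ⟨⟨?_, ?_⟩, fun F hF => le_sSup hF⟩
  · rw [Submodule.map_le_iff_le_comap]
    refine sSup_le fun F hF => ?_
    rw [← Submodule.map_le_iff_le_comap]
    exact hF.1.trans (sup_le_sup_right (le_sSup hF) _)
  · exact sSup_le fun F hF => hF.2

/-- The inputs that, from time `s` on, have the form `u = K z + v`, where `z` is a trajectory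
under `u` with `z s` in the maximal controlled invariant subspace `V`, the gain `K` satisfies
`(A + B K) V ⊆ V`, and `B v` takes values in `V`. -/
def nullingInputs (S : LinearControlSystem σ ι κ) (s : ℝ) : Set (ℝ → ι → ℝ) :=
  {u | PiecewiseContinuous u ∧
    ∃ (K : Matrix ι σ ℝ) (z : ℝ → σ → ℝ) (v : ℝ → ι → ℝ),
      S.maxControlledInvariant.map (S.A + S.B * K).mulVecLin ≤ S.maxControlledInvariant ∧
      S.IsTrajectory u (Ici s) z ∧
      z s ∈ S.maxControlledInvariant ∧
      ∀ t, s ≤ t → S.B *ᵥ v t ∈ S.maxControlledInvariant ∧ u t = K *ᵥ z t + v t}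

end LinearControlSystem

/-- A linear switching system with guards, with locations `Fin N`, continuous state space
`ℝ ^ (n i)` at location `i`, input space `ℝ ^ m` and output space `ℝ ^ l`. The guard `G i h` and
the reset matrix `R i h` matter only for `(i, h) ∈ E`. -/
structure GLSwSystem (N m l : ℕ) where
  n : Fin N → ℕ
  S : (i : Fin N) → LinearControlSystem (Fin (n i)) (Fin m) (Fin l)
  E : Set (Fin N × Fin N)
  G : (i h : Fin N) → Set (Fin (n i) → ℝ)
  R : (i h : Fin N) → Matrix (Fin (n h)) (Fin (n i)) ℝ
  reset_ne_one : ∀ i, (i, i) ∈ E → R i i ≠ 1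

/-- A hybrid time basis: the intervals `I_j = [t_j, t_{j+1})`, `j < L`, with `1 ≤ L ≤ ∞`, where
`t_L = ∞` if `L` is finite, and with finitely many switching times in every bounded interval.
The values `t j` with `j ≥ L` play no role. -/
structure HybridTimeBasis where
  L : ℕ∞
  L_pos : 0 < L
  t : ℕ → ℝ
  lt_succ : ∀ j : ℕ, ((j + 1 : ℕ) : ℕ∞) < L → t j < t (j + 1)
  nonZeno : ∀ b : ℝ, {j : ℕ | (j : ℕ∞) < L ∧ t j ≤ b}.Finite

/-- The interval `I_j = [t_j, t_{j+1})`, which is `[t_j, ∞)` if `j` is the last index. -/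
def HybridTimeBasis.interval (τ : HybridTimeBasis) (j : ℕ) : Set ℝ :=
  {s | τ.t j ≤ s ∧ (((j + 1 : ℕ) : ℕ∞) < τ.L → s < τ.t (j + 1))}

namespace GLSwSystem

variable {N m l : ℕ}

/-- The hybrid state space, the disjoint union of the spaces `{i} × ℝ ^ (n i)`. -/
abbrev HybridState (H : GLSwSystem N m l) : Type := Σ i : Fin N, Fin (H.n i) → ℝ

/-- The Euclidean norm of the continuous component of a hybrid state. -/
noncomputable def contNorm (H : GLSwSystem N m l) (ξ : H.HybridState) : ℝ :=
  ‖(WithLp.toLp 2 ξ.2 : EuclideanSpace ℝ (Fin (H.n ξ.1)))‖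

/-- An execution with time basis `τ`, input `u`, hybrid state evolution `ξ` and output evolution
`y`. On the interval `I_j` the location is `loc j` and the continuous state is `arc j`.
The initial time is `τ.t 0` and the initial hybrid state is `ξ (τ.t 0)`; the values of `ξ` and `y`
before the initial time play no role. -/
structure Execution (H : GLSwSystem N m l) where
  τ : HybridTimeBasis
  u : ℝ → Fin m → ℝ
  ξ : ℝ → H.HybridState
  y : ℝ → Fin l → ℝ
  loc : ℕ → Fin N
  arc : (j : ℕ) → ℝ → Fin (H.n (loc j)) → ℝ
  input_pc : PiecewiseContinuous u
  output_pc : PiecewiseContinuous y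
  state_eq : ∀ j : ℕ, (j : ℕ∞) < τ.L → ∀ s ∈ τ.interval j, ξ s = ⟨loc j, arc j s⟩
  flow : ∀ j : ℕ, (j : ℕ∞) < τ.L → (H.S (loc j)).IsTrajectory u (τ.interval j) (arc j)
  output_eq : ∀ j : ℕ, (j : ℕ∞) < τ.L → ∀ s ∈ τ.interval j, y s = (H.S (loc j)).C *ᵥ arc j s
  jump : ∀ j : ℕ, ((j + 1 : ℕ) : ℕ∞) < τ.L →
    (loc j, loc (j + 1)) ∈ H.E ∧
      ∃ xm : Fin (H.n (loc j)) → ℝ,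
        Tendsto (arc j) (𝓝[<] (τ.t (j + 1))) (𝓝 xm) ∧
        xm ∈ H.G (loc j) (loc (j + 1)) ∧
        arc (j + 1) (τ.t (j + 1)) = H.R (loc j) (loc (j + 1)) *ᵥ xm

/-- Location observability for the input `u`, with initial time `t₀`: some function of the
output on `[t₀, t]` and the input on `[t₀, t)` returns the location at time `t`. -/
def LocationObservableFor (H : GLSwSystem N m l) (t₀ : ℝ) (u : ℝ → Fin m → ℝ) : Prop :=
  ∃ qhat : (t : ℝ) → (Icc t₀ t → Fin l → ℝ) → (Ico t₀ t → Fin m → ℝ) → Fin N,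
    ∀ ρ : ℝ, 0 < ρ → ∃ that : ℝ, t₀ < that ∧
      ∀ χ : H.Execution, χ.τ.t 0 = t₀ → χ.u = u → H.contNorm (χ.ξ t₀) ≤ ρ →
        ∀ t : ℝ, that ≤ t → (∀ j : ℕ, (j : ℕ∞) < χ.τ.L → t ≠ χ.τ.t j) →
          qhat t (fun s => χ.y s) (fun s => u s) = (χ.ξ t).1

/-- Location observability, with initial time `t₀`. -/
def LocationObservable (H : GLSwSystem N m l) (t₀ : ℝ) : Prop :=
  ∃ u : ℝ → Fin m → ℝ, PiecewiseContinuous u ∧ H.LocationObservableFor t₀ u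

/-- The augmented system `S_ih`, whose output is the difference of the outputs of the systems at
the locations `i` and `h` under a common input. -/
def augmented (H : GLSwSystem N m l) (i h : Fin N) :
    LinearControlSystem (Fin (H.n i) ⊕ Fin (H.n h)) (Fin m) (Fin l) where
  A := Matrix.fromBlocks (H.S i).A 0 0 (H.S h).A
  B := Matrix.fromRows (H.S i).B (H.S h).B
  C := Matrix.fromCols (H.S i).C (-(H.S h).C)

/-- The set `U*` of the piecewise continuous inputs that, for every pair of distinct locations,
never coincide on a time interval of positive length with an input that keeps the output of the
augmented system at zero there. -/
def UStar (H : GLSwSystem N m l) : Set (ℝ → Fin m → ℝ) :=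
  {u | PiecewiseContinuous u ∧
    ∀ i h : Fin N, i ≠ h → ∀ s : ℝ, ∀ w ∈ (H.augmented i h).nullingInputs s,
      ¬ ∃ a b : ℝ, s ≤ a ∧ a < b ∧ ∀ t ∈ Icc a b, u t = w t}

/-- For all locations `i ≠ h` there is `k < n_i + n_h` with `C_i A_i^k B_i ≠ C_h A_h^k B_h`. -/
def CondT (H : GLSwSystem N m l) : Prop :=
  ∀ i h : Fin N, i ≠ h → ∃ k : ℕ, k < H.n i + H.n h ∧
    (H.S i).C * (H.S i).A ^ k * (H.S i).B ≠ (H.S h).C * (H.S h).A ^ k * (H.S h).B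

end GLSwSystem

/-! Two locations can be confused only if their augmented system has output zero under the common
input, so everything reduces to zero outputs of one linear system.

Inputs in `UStar` work: if two executions agree in input and output on `[t₀, t]` and neither
switches at `t`, both locations are constant just before `t` and the augmented output vanishes
there. The augmented state then lies in the maximal output-nulling subspace, so the input coincides
on some interval with a nulling input (`exists_nullingInputs_eqOn`), which `UStar` forbids unless
the locations are equal. The location is thus determined by the data at once after `t₀`.

(T) gives `UStar` an element: the input with widely spaced monomials as coordinates. If it produced
a zero output on an interval, differentiating the output and eliminating the state by
Cayley–Hamilton would give a polynomial identity whose coefficients force all relevant Markov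
parameters to vanish (`markov_eq_zero_of_monomial_input`).

(T) is necessary: if it fails for a pair, Cayley–Hamilton makes all Markov parameters of the two
locations agree, so their zero-state responses have the same output for every input. -/

theorem Submodule.mem_of_forall_dual {E : Type*} [AddCommGroup E] [Module ℝ E]
    (F : Submodule ℝ E) {x : E}
    (h : ∀ φ : E →ₗ[ℝ] ℝ, (∀ y ∈ F, φ y = 0) → φ x = 0) : x ∈ F := by
  by_contra hx
  obtain ⟨φ, h1, h2⟩ := F.exists_le_ker_of_notMem hx
  exact h1 (h φ fun y hy => h2 hy)

/-! ### Exponentials of operators -/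

section Exponential

variable {E : Type*} [NormedAddCommGroup E] [NormedSpace ℝ E] [CompleteSpace E]

theorem ContinuousLinearMap.hasSum_exp_apply (L : E →L[ℝ] E) (x : E) :
    HasSum (fun n : ℕ => ((n.factorial : ℝ)⁻¹) • (L ^ n) x) (NormedSpace.exp L x) := by
  have h := NormedSpace.exp_series_hasSum_exp' (𝕂 := ℝ) L
  have h2 := (ContinuousLinearMap.apply ℝ E x).hasSum h
  simpa only [ContinuousLinearMap.apply_apply, _root_.smul_apply] using h2

theorem ContinuousLinearMap.exp_smul_mul_exp_neg_smul (L : E →L[ℝ] E) (s t : ℝ) :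
    NormedSpace.exp (s • L) * NormedSpace.exp ((-t) • L) = NormedSpace.exp ((s - t) • L) := by
  let _ : NormedAlgebra ℚ (E →L[ℝ] E) := NormedAlgebra.restrictScalars ℚ ℝ _
  rw [sub_eq_add_neg, add_smul, NormedSpace.exp_add_of_commute]
  exact ((Commute.refl L).smul_left s).smul_right (-t)

theorem ContinuousLinearMap.exp_smul_apply_exp_neg_smul (L : E →L[ℝ] E) (t : ℝ) (x : E) :
    NormedSpace.exp (t • L) (NormedSpace.exp ((-t) • L) x) = x := by
  have h := L.exp_smul_mul_exp_neg_smul t t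
  rw [sub_self, zero_smul, NormedSpace.exp_zero] at h
  exact congrArg (fun M : E →L[ℝ] E => M x) h

theorem ContinuousLinearMap.continuous_exp_smul (L : E →L[ℝ] E) :
    Continuous fun t : ℝ => NormedSpace.exp (t • L) :=
  continuous_iff_continuousAt.2 fun t => (hasDerivAt_exp_smul_const L t).continuousAt

theorem ContinuousLinearMap.hasDerivAt_exp_neg_smul (L : E →L[ℝ] E) (t : ℝ) :
    HasDerivAt (fun s : ℝ => NormedSpace.exp ((-s) • L))
      (-(NormedSpace.exp ((-t) • L) * L)) t := by
  have h := (hasDerivAt_exp_smul_const L (-t)).scomp t (hasDerivAt_neg t)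
  simpa [Function.comp_def] using h

end Exponential

/-! ### Curves and subspaces in finite dimension -/

section FiniteDimensional

variable {E : Type*} [NormedAddCommGroup E] [NormedSpace ℝ E] [FiniteDimensional ℝ E]

theorem LinearMap.hasDerivAt_comp (φ : E →ₗ[ℝ] ℝ) {z : ℝ → E} {z' : E} {t : ℝ}
    (h : HasDerivAt z z' t) : HasDerivAt (fun s => φ (z s)) (φ z') t :=
  (φ.toContinuousLinearMap.hasFDerivAt (x := z t)).comp_hasDerivAt t h

/-- The partial sums of the exponential series stay in `F`, and a finite-dimensional subspace is
closed. -/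
theorem Submodule.exp_apply_mem (F : Submodule ℝ E) (L : E →L[ℝ] E) (hL : ∀ x ∈ F, L x ∈ F)
    {x : E} (hx : x ∈ F) : NormedSpace.exp L x ∈ F := by
  have : CompleteSpace E := FiniteDimensional.complete ℝ E
  have hp : ∀ n : ℕ, (L ^ n) x ∈ F := by
    intro n
    induction n with
    | zero => simpa using hx
    | succ n ih => rw [pow_succ']; exact hL _ ih
  exact F.closed_of_finiteDimensional.mem_of_tendsto (L.hasSum_exp_apply x)
    (Eventually.of_forall fun s => F.sum_mem fun n _ => F.smul_mem _ (hp n))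

/-- The derivative of a curve lies in every subspace that contains the curve. -/
theorem Submodule.hasDerivAt_mem (F : Submodule ℝ E) {z : ℝ → E} {z' : E} {t : ℝ}
    (h : HasDerivAt z z' t) (hz : ∀ᶠ s in 𝓝 t, z s ∈ F) : z' ∈ F := by
  refine F.mem_of_forall_dual fun φ hφ => ?_
  have h0 : HasDerivAt (fun s => φ (z s)) 0 t :=
    (hasDerivAt_const t (0 : ℝ)).congr_of_eventuallyEq (hz.mono fun s hs => hφ _ hs)
  exact (φ.hasDerivAt_comp h).unique h0

/-- A continuous curve that starts in a subspace and whose velocity lies in it, up to countably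
many instants, stays in the subspace. -/
theorem Submodule.mem_of_hasDerivAt_mem (F : Submodule ℝ E) {z z' : ℝ → E} {D : Set ℝ}
    {s t : ℝ} (hst : s ≤ t) (hD : D.Countable) (hz : ContinuousOn z (Icc s t))
    (hd : ∀ r ∈ Ioo s t \ D, HasDerivAt z (z' r) r ∧ z' r ∈ F) (hs : z s ∈ F) : z t ∈ F := by
  -- Each functional vanishing on `F` has zero derivative along the curve off `D`, so it keeps its
  -- initial value, which is zero.
  refine F.mem_of_forall_dual fun φ hφ => ?_
  have h := MeasureTheory.integral_eq_of_hasDerivAt_off_countable_of_le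
    (fun r => φ (z r)) (fun _ => 0) hst hD
    (φ.continuous_of_finiteDimensional.comp_continuousOn hz)
    (fun r hr => by
      have := φ.hasDerivAt_comp (hd r hr).1
      rwa [hφ _ (hd r hr).2] at this) (by simp)
  simp only [intervalIntegral.integral_zero, hφ _ hs, sub_zero] at h
  exact h.symm

end FiniteDimensional

/-! ### Piecewise continuous functions -/

section PiecewiseContinuous

theorem PiecewiseContinuous.of_continuous {E : Type*} [TopologicalSpace E] {f : ℝ → E}
    (hf : Continuous f) : PiecewiseContinuous f :=
  ⟨⟨∅, by simp, fun t _ => hf.continuousAt⟩, fun t =>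
    ⟨⟨f t, hf.continuousAt.mono_left nhdsWithin_le_nhds⟩,
      ⟨f t, hf.continuousAt.mono_left nhdsWithin_le_nhds⟩⟩⟩

theorem Set.countable_of_finite_inter_Icc {D : Set ℝ} (h : ∀ a b : ℝ, (D ∩ Icc a b).Finite) :
    D.Countable := by
  have : D = ⋃ n : ℕ, D ∩ Icc (-(n : ℝ)) n := by
    ext x
    simp only [mem_iUnion, mem_inter_iff, mem_Icc]
    refine ⟨fun hx => ?_, fun ⟨_, hx, _⟩ => hx⟩
    obtain ⟨n, hn⟩ := exists_nat_ge |x|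
    exact ⟨n, hx, abs_le.1 hn⟩
  rw [this]
  exact countable_iUnion fun n => (h _ _).countable

/-- Every nonempty open interval contains a closed interval on which a piecewise continuous
function is continuous. -/
theorem PiecewiseContinuous.exists_Icc_continuousAt {E : Type*} [TopologicalSpace E] {f : ℝ → E}
    (hf : PiecewiseContinuous f) {a b : ℝ} (hab : a < b) :
    ∃ c d, a < c ∧ c < d ∧ d < b ∧ ∀ t ∈ Icc c d, ContinuousAt f t := by
  obtain ⟨⟨D, hD, hc⟩, -⟩ := hf
  have hfin := hD a b
  obtain ⟨c, hc', hcD⟩ : (Ioo a b \ (D ∩ Icc a b)).Nonempty :=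
    ((Ioo_infinite hab).sdiff hfin).nonempty
  have hopen : IsOpen (Ioo a b \ (D ∩ Icc a b)) := isOpen_Ioo.sdiff hfin.isClosed
  obtain ⟨ε, hε, hball⟩ := Metric.isOpen_iff.1 hopen c ⟨hc', hcD⟩
  have hsub : ∀ t ∈ Icc c (c + ε / 2), t ∈ Ioo a b \ (D ∩ Icc a b) := fun t ht => by
    apply hball
    rw [Metric.mem_ball, Real.dist_eq, abs_lt]
    constructor <;> linarith [ht.1, ht.2]
  refine ⟨c, c + ε / 2, hc'.1, by linarith,
    (hsub _ (right_mem_Icc.2 (by linarith))).1.2, fun t ht => hc t fun htD => ?_⟩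
  exact (hsub t ht).2 ⟨htD, Ioo_subset_Icc_self (hsub t ht).1⟩

/-- Used to continue an input past a chosen instant by a feedback law. -/
theorem PiecewiseContinuous.ite_lt {E : Type*} [TopologicalSpace E] {f g : ℝ → E}
    (hf : PiecewiseContinuous f) (hg : PiecewiseContinuous g) (b : ℝ) :
    PiecewiseContinuous fun t => if t < b then f t else g t := by
  obtain ⟨⟨D, hD, hc⟩, hlim⟩ := hf
  obtain ⟨⟨D', hD', hc'⟩, hlim'⟩ := hg
  have hl : ∀ t < b, (fun t => if t < b then f t else g t) =ᶠ[𝓝 t] f := fun t ht =>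
    (eventually_lt_nhds ht).mono fun s hs => if_pos hs
  have hr : ∀ t > b, (fun t => if t < b then f t else g t) =ᶠ[𝓝 t] g := fun t ht =>
    (eventually_gt_nhds ht).mono fun s hs => if_neg (not_lt.2 hs.le)
  have hl' : (fun t => if t < b then f t else g t) =ᶠ[𝓝[<] b] f :=
    eventually_mem_nhdsWithin.mono fun s hs => if_pos hs
  have hr' : (fun t => if t < b then f t else g t) =ᶠ[𝓝[>] b] g :=
    eventually_mem_nhdsWithin.mono fun s hs => if_neg (not_lt.2 (le_of_lt hs))
  refine ⟨⟨D ∪ D' ∪ {b}, fun p q => ?_, fun t ht => ?_⟩, fun t => ?_⟩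
  · rw [union_inter_distrib_right, union_inter_distrib_right]
    exact ((hD p q).union (hD' p q)).union ((finite_singleton b).inter_of_left _)
  · simp only [mem_union, mem_singleton_iff, not_or] at ht
    rcases lt_or_gt_of_ne ht.2 with h | h
    · exact (hc t ht.1.1).congr (hl t h).symm
    · exact (hc' t ht.1.2).congr (hr t h).symm
  · obtain ⟨⟨y₁, h₁⟩, ⟨y₂, h₂⟩⟩ := hlim t
    obtain ⟨⟨y₁', h₁'⟩, ⟨y₂', h₂'⟩⟩ := hlim' t
    rcases lt_trichotomy t b with h | rfl | h
    · exact ⟨⟨y₁, h₁.congr' ((hl t h).filter_mono nhdsWithin_le_nhds).symm⟩,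
        ⟨y₂, h₂.congr' ((hl t h).filter_mono nhdsWithin_le_nhds).symm⟩⟩
    · exact ⟨⟨y₁, h₁.congr' hl'.symm⟩, ⟨y₂', h₂'.congr' hr'.symm⟩⟩
    · exact ⟨⟨y₁', h₁'.congr' ((hr t h).filter_mono nhdsWithin_le_nhds).symm⟩,
        ⟨y₂', h₂'.congr' ((hr t h).filter_mono nhdsWithin_le_nhds).symm⟩⟩

theorem PiecewiseContinuous.clm_apply {E F : Type*} [NormedAddCommGroup E] [NormedSpace ℝ E]
    [NormedAddCommGroup F] [NormedSpace ℝ F] {f : ℝ → E} (hf : PiecewiseContinuous f)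
    {Φ : ℝ → E →L[ℝ] F} (hΦ : Continuous Φ) : PiecewiseContinuous fun t => Φ t (f t) := by
  obtain ⟨⟨D, hD, hc⟩, hlim⟩ := hf
  refine ⟨⟨D, hD, fun t ht => hΦ.continuousAt.clm_apply (hc t ht)⟩, fun t => ?_⟩
  obtain ⟨⟨y₁, h₁⟩, ⟨y₂, h₂⟩⟩ := hlim t
  have hl : ∀ s : Set ℝ, Tendsto Φ (𝓝[s] t) (𝓝 (Φ t)) := fun s =>
    hΦ.continuousAt.mono_left nhdsWithin_le_nhds
  have happ := fun p => (isBoundedBilinearMap_apply (𝕜 := ℝ) (E := E) (F := F)).continuous.tendsto p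
  exact ⟨⟨_, (happ (Φ t, y₁)).comp ((hl _).prodMk_nhds h₁)⟩,
    ⟨_, (happ (Φ t, y₂)).comp ((hl _).prodMk_nhds h₂)⟩⟩

variable {E : Type*} [NormedAddCommGroup E]

theorem PiecewiseContinuous.aestronglyMeasurable [SecondCountableTopologyEither ℝ E] {f : ℝ → E}
    (hf : PiecewiseContinuous f) :
    MeasureTheory.AEStronglyMeasurable f MeasureTheory.volume := by
  obtain ⟨⟨D, hD, hc⟩, -⟩ := hf
  have hDc := Set.countable_of_finite_inter_Icc hD
  have h1 : MeasureTheory.AEStronglyMeasurable f (MeasureTheory.volume.restrict Dᶜ) :=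
    ContinuousOn.aestronglyMeasurable (fun t ht => (hc t ht).continuousWithinAt)
      hDc.measurableSet.compl
  rwa [MeasureTheory.Measure.restrict_eq_self_of_ae_mem] at h1
  exact MeasureTheory.compl_mem_ae_iff.2 (hDc.measure_zero _)

theorem PiecewiseContinuous.intervalIntegrable [SecondCountableTopologyEither ℝ E] {f : ℝ → E}
    (hf : PiecewiseContinuous f) (a b : ℝ) :
    IntervalIntegrable f MeasureTheory.volume a b := by
  have hm := hf.aestronglyMeasurable
  have hl : MeasureTheory.LocallyIntegrable f MeasureTheory.volume := by
    intro t
    obtain ⟨⟨y₁, h₁⟩, ⟨y₂, h₂⟩⟩ := hf.2 t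
    have hfin : ∀ s : Set ℝ, (MeasureTheory.volume : MeasureTheory.Measure ℝ).FiniteAtFilter
        (𝓝[s] t) := fun s =>
      (MeasureTheory.Measure.finiteAt_nhds MeasureTheory.volume t).filter_mono nhdsWithin_le_nhds
    -- Integrability near `t` is checked separately on the left, on the right and at `t` itself; on
    -- each piece the function has a limit.
    have e : 𝓝 t = (𝓝[<] t ⊔ 𝓝[>] t) ⊔ 𝓝[{t}] t := by
      rw [nhdsLT_sup_nhdsGT, ← nhdsWithin_union, compl_union_self, nhdsWithin_univ]
    have := (measurableSet_singleton t).nhdsWithin_isMeasurablyGenerated t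
    rw [e, MeasureTheory.IntegrableAtFilter.sup_iff, MeasureTheory.IntegrableAtFilter.sup_iff]
    refine ⟨⟨(hfin _).integrableAtFilter_of_tendsto hm.stronglyMeasurableAtFilter h₁,
      (hfin _).integrableAtFilter_of_tendsto hm.stronglyMeasurableAtFilter h₂⟩,
      (hfin _).integrableAtFilter_of_tendsto (b := f t) hm.stronglyMeasurableAtFilter ?_⟩
    rw [nhdsWithin_singleton]
    exact tendsto_pure_nhds f t
  exact (hl.integrableOn_isCompact isCompact_uIcc).intervalIntegrable

end PiecewiseContinuous

/-! ### Variation of constants -/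

section VariationOfConstants

variable {E : Type*} [NormedAddCommGroup E] [NormedSpace ℝ E]

/-- The solution of `x' = L x + f` that vanishes at `t₀`. -/
noncomputable def forcedResponse (L : E →L[ℝ] E) (f : ℝ → E) (t₀ t : ℝ) : E :=
  NormedSpace.exp (t • L) (∫ s in t₀..t, NormedSpace.exp ((-s) • L) (f s))

theorem forcedResponse_self (L : E →L[ℝ] E) (f : ℝ → E) (t₀ : ℝ) : forcedResponse L f t₀ t₀ = 0 := by
  simp [forcedResponse]

variable [FiniteDimensional ℝ E] (L : E →L[ℝ] E) {f : ℝ → E} (t₀ : ℝ)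

theorem PiecewiseContinuous.exp_neg_smul_apply (hf : PiecewiseContinuous f) :
    PiecewiseContinuous fun s => NormedSpace.exp ((-s) • L) (f s) := by
  have : CompleteSpace E := FiniteDimensional.complete ℝ E
  exact hf.clm_apply (L.continuous_exp_smul.comp continuous_neg)

theorem continuous_forcedResponse (hf : PiecewiseContinuous f) :
    Continuous (forcedResponse L f t₀) := by
  have : CompleteSpace E := FiniteDimensional.complete ℝ E
  exact L.continuous_exp_smul.clm_apply
    (intervalIntegral.continuous_primitive (hf.exp_neg_smul_apply L).intervalIntegrable t₀)

theorem hasDerivAt_forcedResponse (hf : PiecewiseContinuous f) {t : ℝ} (ht : ContinuousAt f t) :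
    HasDerivAt (forcedResponse L f t₀) (L (forcedResponse L f t₀ t) + f t) t := by
  have : CompleteSpace E := FiniteDimensional.complete ℝ E
  have hg := hf.exp_neg_smul_apply L
  have h1 := intervalIntegral.integral_hasDerivAt_right (hg.intervalIntegrable t₀ t)
    hg.aestronglyMeasurable.stronglyMeasurableAtFilter
    ((L.continuous_exp_smul.comp continuous_neg).continuousAt.clm_apply ht)
  have h2 := (hasDerivAt_exp_smul_const' L t).clm_apply h1
  rw [L.exp_smul_apply_exp_neg_smul] at h2
  exact h2

/-- With `c` an output map, the kernel `c ∘ exp ((t - s) • L)` expands into a power series that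
exhibits the Markov parameters. -/
theorem clm_apply_forcedResponse {F : Type*} [NormedAddCommGroup F]
    [NormedSpace ℝ F] [CompleteSpace F] (c : E →L[ℝ] F) (hf : PiecewiseContinuous f) (t : ℝ) :
    c (forcedResponse L f t₀ t) = ∫ s in t₀..t, c (NormedSpace.exp ((t - s) • L) (f s)) := by
  have : CompleteSpace E := FiniteDimensional.complete ℝ E
  have h := (c.comp (NormedSpace.exp (t • L))).intervalIntegral_comp_comm
    ((hf.exp_neg_smul_apply L).intervalIntegrable t₀ t)
  rw [forcedResponse, ← ContinuousLinearMap.comp_apply, ← h]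
  refine intervalIntegral.integral_congr fun s _ => ?_
  simp only [ContinuousLinearMap.comp_apply, ← L.exp_smul_mul_exp_neg_smul t s,
    mul_apply_eq_comp]

end VariationOfConstants

/-- Multiplication of vectors by a matrix, as a continuous linear map. -/
noncomputable def Matrix.mulVecContinuousLin {σ κ : Type*} [Fintype σ] (M : Matrix κ σ ℝ) :
    (σ → ℝ) →L[ℝ] (κ → ℝ) :=
  LinearMap.toContinuousLinearMap M.mulVecLin

@[simp]
theorem Matrix.mulVecContinuousLin_apply {σ κ : Type*} [Fintype σ] (M : Matrix κ σ ℝ)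
    (x : σ → ℝ) : M.mulVecContinuousLin x = M *ᵥ x := rfl

theorem Matrix.mulVecContinuousLin_pow_apply {σ : Type*} [Fintype σ] [DecidableEq σ]
    (M : Matrix σ σ ℝ) (k : ℕ) (x : σ → ℝ) : (M.mulVecContinuousLin ^ k) x = (M ^ k) *ᵥ x := by
  induction k generalizing x with
  | zero => simp
  | succ k ih => rw [pow_succ, pow_succ, mul_apply_eq_comp, ih, mulVecContinuousLin_apply,
      Matrix.mulVec_mulVec]

/-! ### Output-nulling subspaces and nulling inputs -/

namespace LinearControlSystem

/-- If the Markov parameters vanish up to the dimension of the state, then all do. -/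
theorem markov_eq_zero_of_lt_card {σ ι κ : Type*} [Fintype σ] [DecidableEq σ]
    (S : LinearControlSystem σ ι κ)
    (h : ∀ k < Fintype.card σ, S.C * S.A ^ k * S.B = 0) (k : ℕ) : S.C * S.A ^ k * S.B = 0 := by
  rw [S.A.pow_eq_aeval_mod_charpoly]
  -- Without states the characteristic polynomial is `1`, and the strict degree bound on the
  -- remainder fails.
  rcases isEmpty_or_nonempty σ with hσ | hσ
  · ext i j
    simp [Matrix.mul_apply]
  have hdeg : (Polynomial.X ^ k %ₘ S.A.charpoly).natDegree < Fintype.card σ := by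
    rw [← S.A.charpoly_natDegree_eq_dim]
    refine Polynomial.natDegree_modByMonic_lt _ S.A.charpoly_monic fun h1 => ?_
    have := S.A.charpoly_natDegree_eq_dim
    rw [h1, Polynomial.natDegree_one] at this
    exact Fintype.card_ne_zero this.symm
  rw [Polynomial.aeval_eq_sum_range' hdeg, Matrix.mul_sum, Matrix.sum_mul]
  refine Finset.sum_eq_zero fun i hi => ?_
  rw [Matrix.mul_smul, Matrix.smul_mul, h i (Finset.mem_range.1 hi), smul_zero]

variable {σ ι κ : Type*} [Fintype σ] [Fintype ι]

/-- A controlled invariant subspace has a feedback gain that makes it invariant. -/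
theorem exists_gain_map_le (S : LinearControlSystem σ ι κ) {F : Submodule ℝ (σ → ℝ)}
    (hF : F.map S.A.mulVecLin ≤ F ⊔ LinearMap.range S.B.mulVecLin) :
    ∃ K : Matrix ι σ ℝ, F.map (S.A + S.B * K).mulVecLin ≤ F := by
  classical
  have h : ∀ x : F, ∃ w, S.A *ᵥ (x : σ → ℝ) + S.B *ᵥ w ∈ F := by
    intro x
    obtain ⟨y, hy, _, ⟨w, rfl⟩, hyw⟩ := Submodule.mem_sup.1 (hF (Submodule.mem_map_of_mem x.2))
    refine ⟨-w, ?_⟩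
    rw [Matrix.mulVecLin_apply, Matrix.mulVecLin_apply] at hyw
    rwa [← hyw, Matrix.mulVec_neg, add_neg_cancel_right]
  choose f hf using h
  let b := Module.finBasis ℝ F
  let k : F →ₗ[ℝ] (ι → ℝ) := b.constr ℝ fun i => f (b i)
  -- The choice `f` need not be linear, so only its values on a basis are kept; invariance, read
  -- modulo `F`, is the vanishing of a linear map and may be tested on that basis.
  have hk : F.mkQ ∘ₗ (S.A.mulVecLin ∘ₗ F.subtype + S.B.mulVecLin ∘ₗ k) = 0 := by
    refine b.ext fun i => ?_
    have : k (b i) = f (b i) := b.constr_basis ℝ _ i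
    simpa [this, ← Submodule.Quotient.mk_add, Submodule.Quotient.mk_eq_zero] using hf (b i)
  obtain ⟨g, hg⟩ := LinearMap.exists_extend k
  refine ⟨LinearMap.toMatrix' g, ?_⟩
  rintro _ ⟨x, hx, rfl⟩
  have h1 := LinearMap.congr_fun hk ⟨x, hx⟩
  have h2 : k ⟨x, hx⟩ = g x := by rw [← hg]; rfl
  have h3 : S.A *ᵥ x + S.B *ᵥ g x ∈ F := by
    rw [← h2]
    exact (Submodule.Quotient.mk_eq_zero F).1 h1
  rwa [Matrix.mulVecLin_apply, Matrix.add_mulVec, ← Matrix.mulVec_mulVec,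
    LinearMap.toMatrix'_mulVec]

/-- A motion with zero output stays in the maximal output-nulling subspace. -/
theorem mem_maxControlledInvariant_of_output_eq_zero (S : LinearControlSystem σ ι κ)
    {u : ℝ → ι → ℝ} {z : ℝ → σ → ℝ} {I : Set ℝ} (hI : IsOpen I)
    (hz : ∀ t ∈ I, HasDerivAt z (S.A *ᵥ z t + S.B *ᵥ u t) t)
    (h0 : ∀ t ∈ I, S.C *ᵥ z t = 0) {t : ℝ} (ht : t ∈ I) : z t ∈ S.maxControlledInvariant := by
  -- The span of the motion contains its velocity, and `A z` is the velocity minus `B u`.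
  have hnull : S.IsOutputNulling (Submodule.span ℝ (z '' I)) := by
    constructor
    · rw [Submodule.map_span, Submodule.span_le]
      rintro _ ⟨_, ⟨r, hr, rfl⟩, rfl⟩
      have h1 := (Submodule.span ℝ (z '' I)).hasDerivAt_mem (hz r hr)
        ((hI.eventually_mem hr).mono fun s hs => Submodule.subset_span ⟨s, hs, rfl⟩)
      refine Submodule.mem_sup.2 ⟨_, h1, S.B.mulVecLin (-u r), ⟨_, rfl⟩, ?_⟩
      simp [Matrix.mulVec_neg]
    · rw [Submodule.span_le]
      rintro _ ⟨r, hr, rfl⟩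
      exact h0 r hr
  exact le_sSup (a := Submodule.span ℝ (z '' I)) hnull (Submodule.subset_span ⟨t, ht, rfl⟩)

/-- An input that produces a zero output on an interval coincides there, on a smaller interval,
with a nulling input. -/
theorem exists_nullingInputs_eqOn (S : LinearControlSystem σ ι κ) {u : ℝ → ι → ℝ}
    (hu : PiecewiseContinuous u) {z : ℝ → σ → ℝ} {a b : ℝ} (hab : a < b)
    (hz : ∀ t ∈ Ioo a b, ContinuousAt u t → HasDerivAt z (S.A *ᵥ z t + S.B *ᵥ u t) t)
    (h0 : ∀ t ∈ Ioo a b, S.C *ᵥ z t = 0) :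
    ∃ s, ∃ w ∈ S.nullingInputs s, ∃ c, s < c ∧ ∀ t ∈ Icc s c, u t = w t := by
  obtain ⟨p, q, hap, hpq, hqb, hcont⟩ := hu.exists_Icc_continuousAt hab
  have hsub : ∀ t ∈ Ioo p q, t ∈ Ioo a b := fun t ht => ⟨hap.trans ht.1, ht.2.trans hqb⟩
  have hz' : ∀ t ∈ Ioo p q, HasDerivAt z (S.A *ᵥ z t + S.B *ᵥ u t) t := fun t ht =>
    hz t (hsub t ht) (hcont t (Ioo_subset_Icc_self ht))
  set V := S.maxControlledInvariant
  have hzV : ∀ t ∈ Ioo p q, z t ∈ V := fun t ht =>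
    S.mem_maxControlledInvariant_of_output_eq_zero isOpen_Ioo hz'
      (fun r hr => h0 r (hsub r hr)) ht
  have hvV : ∀ t ∈ Ioo p q, S.A *ᵥ z t + S.B *ᵥ u t ∈ V := fun t ht =>
    V.hasDerivAt_mem (hz' t ht) ((isOpen_Ioo.eventually_mem ht).mono hzV)
  obtain ⟨K, hK⟩ := S.exists_gain_map_le S.isGreatest_maxControlledInvariant.1.1
  have hKV : ∀ x ∈ V, S.A *ᵥ x + S.B *ᵥ K *ᵥ x ∈ V := fun x hx => by
    have := hK (Submodule.mem_map_of_mem hx)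
    rwa [Matrix.mulVecLin_apply, Matrix.add_mulVec, ← Matrix.mulVec_mulVec] at this
  obtain ⟨s, hps, hsq⟩ := exists_between hpq
  obtain ⟨e, hse, heq⟩ := exists_between hsq
  have hepq : e ∈ Ioo p q := ⟨hps.trans hse, heq⟩
  let L := (S.A + S.B * K).mulVecContinuousLin
  have hL : ∀ x, L x = S.A *ᵥ x + S.B *ᵥ K *ᵥ x := fun x => by
    simp only [L, Matrix.mulVecContinuousLin_apply, Matrix.add_mulVec, Matrix.mulVec_mulVec]
  let z₂ : ℝ → σ → ℝ := fun t => NormedSpace.exp ((t - e) • L) (z e)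
  have hz₂e : z₂ e = z e := by simp [z₂]
  have hz₂ : ∀ t, HasDerivAt z₂ (L (z₂ t)) t := fun t => by
    have h1 : HasDerivAt (fun t : ℝ => NormedSpace.exp ((t - e) • L))
        (L * NormedSpace.exp ((t - e) • L)) t :=
      (hasDerivAt_exp_smul_const' (𝕂 := ℝ) L (t - e)).comp_sub_const t e
    simpa using h1.clm_apply (hasDerivAt_const t (z e))
  -- A nulling input needs a trajectory on all of `[s, ∞)`, while `z` is controlled only on `(a,
  -- b)`; from `e` on, the closed loop `A + B K` takes over.
  let Z : ℝ → σ → ℝ := fun t => if t < e then z t else z₂ t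
  let w : ℝ → ι → ℝ := fun t => if t < e then u t else K *ᵥ z₂ t
  have hw : PiecewiseContinuous w := hu.ite_lt (.of_continuous
    (K.mulVecContinuousLin.continuous.comp
      (continuous_iff_continuousAt.2 fun t => (hz₂ t).continuousAt))) e
  have hlt : ∀ t < e, Z t = z t ∧ w t = u t := fun t ht => ⟨if_pos ht, if_pos ht⟩
  have hge : ∀ t ≥ e, Z t = z₂ t ∧ w t = K *ᵥ z₂ t := fun t ht =>
    ⟨if_neg (not_lt.2 ht), if_neg (not_lt.2 ht)⟩
  have hleft : HasDerivWithinAt Z (S.A *ᵥ z e + S.B *ᵥ u e) (Iic e) e :=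
    (hz' e hepq).hasDerivWithinAt.congr (fun t ht => by
      rcases lt_or_eq_of_le (mem_Iic.1 ht) with h | rfl
      · exact (hlt t h).1
      · rw [(hge t le_rfl).1, hz₂e]) (by rw [(hge e le_rfl).1, hz₂e])
  have hright : HasDerivWithinAt Z (L (z₂ e)) (Ici e) e :=
    (hz₂ e).hasDerivWithinAt.congr (fun t ht => (hge t ht).1) (hge e le_rfl).1
  have htraj : ∀ t, p < t → ContinuousAt Z t ∧
      (ContinuousAt w t → HasDerivAt Z (S.A *ᵥ Z t + S.B *ᵥ w t) t) := by
    intro t hpt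
    rcases lt_trichotomy t e with h | rfl | h
    · have hZ : HasDerivAt Z (S.A *ᵥ Z t + S.B *ᵥ w t) t := by
        rw [(hlt t h).1, (hlt t h).2]
        exact (hz' t ⟨hpt, h.trans heq⟩).congr_of_eventuallyEq
          ((eventually_lt_nhds h).mono fun r hr => (hlt r hr).1)
      exact ⟨hZ.continuousAt, fun _ => hZ⟩
    -- At the junction the equation is required only if `w` is continuous there; then `u` and `w`
    -- agree at that instant, and the two one-sided derivatives match.
    · refine ⟨continuousAt_iff_continuous_left_right.2
        ⟨hleft.continuousWithinAt, hright.continuousWithinAt⟩, fun hwc => ?_⟩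
      have hut : u t = w t := by
        have h1 : Tendsto w (𝓝[<] t) (𝓝 (w t)) := hwc.mono_left nhdsWithin_le_nhds
        have h2 : Tendsto w (𝓝[<] t) (𝓝 (u t)) :=
          ((hcont t (Ioo_subset_Icc_self hepq)).mono_left nhdsWithin_le_nhds).congr'
            (eventually_mem_nhdsWithin.mono fun r hr => (hlt r hr).2.symm)
        exact tendsto_nhds_unique h2 h1
      have e1 : S.A *ᵥ z t + S.B *ᵥ u t = S.A *ᵥ Z t + S.B *ᵥ w t := by
        rw [hut, (hge t le_rfl).1, hz₂e]
      have e2 : L (z₂ t) = S.A *ᵥ Z t + S.B *ᵥ w t := by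
        rw [hL, (hge t le_rfl).1, (hge t le_rfl).2]
      rw [e1] at hleft
      rw [e2] at hright
      have := hleft.union hright
      rwa [Iic_union_Ici, hasDerivWithinAt_univ] at this
    · have hZ : HasDerivAt Z (S.A *ᵥ Z t + S.B *ᵥ w t) t := by
        rw [(hge t h.le).1, (hge t h.le).2, ← hL]
        exact (hz₂ t).congr_of_eventuallyEq
          ((eventually_gt_nhds h).mono fun r hr => (hge r (le_of_lt hr)).1)
      exact ⟨hZ.continuousAt, fun _ => hZ⟩
  obtain ⟨c, hsc, hce⟩ := exists_between hse
  refine ⟨s, w, ⟨hw, K, Z, fun t => if t < e then u t - K *ᵥ z t else 0, hK,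
    ⟨fun t ht => (htraj t (hps.trans_le ht)).1.continuousWithinAt, fun t ht hc => ?_⟩, ?_,
    fun t ht => ?_⟩, c, hsc, fun t ht => ((hlt t (ht.2.trans_lt hce)).2).symm⟩
  · exact (htraj t (hps.trans_le (interior_subset ht))).2 hc
  · rw [(hlt s hse).1]
    exact hzV s ⟨hps, hsq⟩
  · beta_reduce
    rcases lt_or_ge t e with h | h
    · have htpq : t ∈ Ioo p q := ⟨hps.trans_le ht, h.trans heq⟩
      rw [if_pos h, (hlt t h).1, (hlt t h).2, add_sub_cancel, Matrix.mulVec_sub]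
      refine ⟨?_, rfl⟩
      -- `B v` is the velocity of `z` minus `(A + B K) z`, and both lie in `V`.
      have := V.sub_mem (hvV t htpq) (hKV _ (hzV t htpq))
      rwa [add_sub_add_left_eq_sub] at this
    · rw [if_neg (not_lt.2 h), (hge t h).1, (hge t h).2]
      simp

/-- A nulling input keeps its trajectory in the maximal output-nulling subspace. -/
theorem mem_maxControlledInvariant_of_feedback (S : LinearControlSystem σ ι κ) {s : ℝ}
    {u v : ℝ → ι → ℝ} {z : ℝ → σ → ℝ} {K : Matrix ι σ ℝ} (hu : PiecewiseContinuous u)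
    (hK : S.maxControlledInvariant.map (S.A + S.B * K).mulVecLin ≤ S.maxControlledInvariant)
    (hz : S.IsTrajectory u (Ici s) z) (hs : z s ∈ S.maxControlledInvariant)
    (hv : ∀ t, s ≤ t → S.B *ᵥ v t ∈ S.maxControlledInvariant ∧ u t = K *ᵥ z t + v t)
    {t : ℝ} (ht : s ≤ t) : z t ∈ S.maxControlledInvariant := by
  set V := S.maxControlledInvariant
  obtain ⟨⟨D, hD, hc⟩, -⟩ := hu
  let L := (S.A + S.B * K).mulVecContinuousLin
  have hLV : ∀ r : ℝ, ∀ x ∈ V, (r • L) x ∈ V := fun r x hx =>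
    V.smul_mem r (hK (Submodule.mem_map_of_mem hx))
  -- Undoing the closed-loop flow, which preserves `V`, leaves a curve with velocity `exp (-r L) (B
  -- v r)` in `V`.
  have key := V.mem_of_hasDerivAt_mem (z := fun r => NormedSpace.exp ((-r) • L) (z r))
    (z' := fun r => NormedSpace.exp ((-r) • L) (S.B *ᵥ v r)) ht
    (Set.countable_of_finite_inter_Icc hD)
    (((L.continuous_exp_smul.comp continuous_neg).continuousOn).clm_apply
      (hz.1.mono Icc_subset_Ici_self))
    (fun r hr => ⟨?_, V.exp_apply_mem _ (hLV _) (hv r hr.1.1.le).1⟩)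
    (V.exp_apply_mem _ (hLV _) hs)
  · have := V.exp_apply_mem _ (hLV t) key
    rwa [L.exp_smul_apply_exp_neg_smul] at this
  · have h1 := hz.2 r (by rw [interior_Ici]; exact hr.1.1) (hc r hr.2)
    have h2 := (L.hasDerivAt_exp_neg_smul r).clm_apply h1
    refine h2.congr_deriv ?_
    rw [_root_.neg_apply, mul_apply_eq_comp, neg_add_eq_sub, ← map_sub]
    congr 1
    simp only [L, Matrix.mulVecContinuousLin_apply, Matrix.add_mulVec, (hv r hr.1.1.le).2,
      Matrix.mulVec_add, Matrix.mulVec_mulVec]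
    abel

theorem isTrajectory_forcedResponse (S : LinearControlSystem σ ι κ) {u : ℝ → ι → ℝ}
    (hu : PiecewiseContinuous u) (t₀ : ℝ) (I : Set ℝ) :
    S.IsTrajectory u I (forcedResponse S.A.mulVecContinuousLin (fun s => S.B *ᵥ u s) t₀) := by
  have hB : PiecewiseContinuous fun s => S.B *ᵥ u s :=
    hu.clm_apply (Φ := fun _ => S.B.mulVecContinuousLin) continuous_const
  exact ⟨(continuous_forcedResponse _ t₀ hB).continuousOn, fun t _ ht =>
    hasDerivAt_forcedResponse _ t₀ hB
      (S.B.mulVecContinuousLin.continuous.continuousAt.comp ht)⟩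

/-! ### Markov parameters and outputs -/

variable [DecidableEq σ]

/-- Systems with equal Markov parameters have equal zero-state responses. -/
theorem output_forcedResponse_eq {σ' : Type*} [Fintype σ'] [DecidableEq σ'] [Fintype κ]
    (S : LinearControlSystem σ ι κ) (S' : LinearControlSystem σ' ι κ)
    (h : ∀ k, S.C * S.A ^ k * S.B = S'.C * S'.A ^ k * S'.B) {u : ℝ → ι → ℝ}
    (hu : PiecewiseContinuous u) (t₀ t : ℝ) :
    S.C *ᵥ forcedResponse S.A.mulVecContinuousLin (fun s => S.B *ᵥ u s) t₀ t =
      S'.C *ᵥ forcedResponse S'.A.mulVecContinuousLin (fun s => S'.B *ᵥ u s) t₀ t := by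
  have hB : PiecewiseContinuous fun s => S.B *ᵥ u s :=
    hu.clm_apply (Φ := fun _ => S.B.mulVecContinuousLin) continuous_const
  have hB' : PiecewiseContinuous fun s => S'.B *ᵥ u s :=
    hu.clm_apply (Φ := fun _ => S'.B.mulVecContinuousLin) continuous_const
  have e := clm_apply_forcedResponse S.A.mulVecContinuousLin t₀ S.C.mulVecContinuousLin hB t
  have e' := clm_apply_forcedResponse S'.A.mulVecContinuousLin t₀ S'.C.mulVecContinuousLin hB' t
  rw [Matrix.mulVecContinuousLin_apply] at e e'
  rw [e, e']
  refine intervalIntegral.integral_congr fun s _ => ?_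
  -- Both integrands are sums of exponential series whose terms coincide by equality of the Markov
  -- parameters.
  have hs := S.C.mulVecContinuousLin.hasSum
    (((t - s) • S.A.mulVecContinuousLin).hasSum_exp_apply (S.B *ᵥ u s))
  have hs' := S'.C.mulVecContinuousLin.hasSum
    (((t - s) • S'.A.mulVecContinuousLin).hasSum_exp_apply (S'.B *ᵥ u s))
  refine hs.unique ?_
  convert hs' using 2 with n
  simp only [map_smul, smul_pow, _root_.smul_apply,
    Matrix.mulVecContinuousLin_pow_apply, Matrix.mulVecContinuousLin_apply, Matrix.mulVec_mulVec,
    ← Matrix.mul_assoc, h n]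

/-- The derivatives of a zero output, along a polynomial input. -/
theorem iteratedDeriv_output_eq_zero [Fintype κ] (S : LinearControlSystem σ ι κ)
    {P : ι → Polynomial ℝ} {z : ℝ → σ → ℝ} {I : Set ℝ} (hI : IsOpen I)
    (hz : ∀ t ∈ I, HasDerivAt z (S.A *ᵥ z t + S.B *ᵥ fun μ => (P μ).eval t) t)
    (h0 : ∀ t ∈ I, S.C *ᵥ z t = 0) (k : ℕ) : ∀ t ∈ I,
    (S.C * S.A ^ k) *ᵥ z t + ∑ j ∈ Finset.range k, (S.C * S.A ^ (k - (j + 1)) * S.B) *ᵥ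
      (fun μ => (Polynomial.derivative^[j] (P μ)).eval t) = 0 := by
  induction k with
  | zero => simpa using h0
  | succ k ih =>
    intro t ht
    have hU : ∀ j, HasDerivAt (fun t μ => (Polynomial.derivative^[j] (P μ)).eval t)
        (fun μ => (Polynomial.derivative^[j + 1] (P μ)).eval t) t := fun j =>
      hasDerivAt_pi.2 fun μ => by
        rw [Function.iterate_succ_apply']
        exact Polynomial.hasDerivAt _ t
    have hsum : HasDerivAt
        (fun t => ∑ j ∈ Finset.range k, (S.C * S.A ^ (k - (j + 1)) * S.B) *ᵥ
          (fun μ => (Polynomial.derivative^[j] (P μ)).eval t))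
        (∑ j ∈ Finset.range k, (S.C * S.A ^ (k - (j + 1)) * S.B) *ᵥ
          (fun μ => (Polynomial.derivative^[j + 1] (P μ)).eval t)) t :=
      HasDerivAt.fun_sum fun j _ => (S.C * S.A ^ (k - (j + 1)) *
        S.B).mulVecContinuousLin.hasFDerivAt.comp_hasDerivAt t (hU j)
    have hd := ((S.C * S.A ^ k).mulVecContinuousLin.hasFDerivAt.comp_hasDerivAt t
      (hz t ht)).add hsum
    rw [Matrix.mulVecContinuousLin_apply] at hd
    have h := (⊥ : Submodule ℝ (κ → ℝ)).hasDerivAt_mem hd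
      ((hI.eventually_mem ht).mono fun s hs => (Submodule.mem_bot ℝ).2 (ih s hs))
    rw [Submodule.mem_bot] at h
    -- Differentiation shifts the old terms to `j + 1`; the new term `j = 0` comes from the input
    -- part of the state equation.
    rw [Finset.sum_range_succ', ← h, Matrix.mulVec_add, Matrix.mulVec_mulVec,
      Matrix.mulVec_mulVec, pow_succ]
    simp only [Nat.add_sub_add_right, zero_add, Nat.add_sub_cancel, Function.iterate_zero, id,
      Matrix.mul_assoc]
    abel

/-- If a motion has zero output under the input with coordinates `t ^ ((μ + 1) M)`, where `M` is
at least the dimension of the state, then the Markov parameters vanish. -/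
theorem markov_eq_zero_of_monomial_input {m : ℕ} [Fintype κ]
    (S : LinearControlSystem σ (Fin m) κ) {M : ℕ} (hM : Fintype.card σ ≤ M) {z : ℝ → σ → ℝ}
    {a b : ℝ} (hab : a < b)
    (hz : ∀ t ∈ Ioo a b,
      HasDerivAt z (S.A *ᵥ z t + S.B *ᵥ fun μ : Fin m => t ^ (((μ : ℕ) + 1) * M)) t)
    (h0 : ∀ t ∈ Ioo a b, S.C *ᵥ z t = 0) (r : ℕ) (hr : r < Fintype.card σ) :
    S.C * S.A ^ r * S.B = 0 := by
  induction r using Nat.strong_induction_on with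
  | _ r ih =>
  set n := Fintype.card σ
  let d : Fin m → ℕ := fun μ => ((μ : ℕ) + 1) * M
  let P : Fin m → Polynomial ℝ := fun μ => Polynomial.X ^ d μ
  have hz' : ∀ t ∈ Ioo a b, HasDerivAt z (S.A *ᵥ z t + S.B *ᵥ fun μ => (P μ).eval t) t := by
    simpa [P, d] using hz
  let p := S.A.charpoly
  have hp : p.natDegree = n := S.A.charpoly_natDegree_eq_dim
  ext α μ₀
  -- Row `α` of the output derivatives weighted by the characteristic coefficients: Cayley–Hamilton
  -- removes the state, leaving a polynomial in time.
  let Q : Polynomial ℝ := ∑ k ∈ Finset.range (n + 1), ∑ j ∈ Finset.range k, ∑ μ,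
    Polynomial.C (p.coeff k * (S.C * S.A ^ (k - (j + 1)) * S.B) α μ) *
      Polynomial.derivative^[j] (P μ)
  have hQ : Q = 0 := by
    refine Polynomial.eq_zero_of_infinite_isRoot Q ((Ioo_infinite hab).mono fun t ht => ?_)
    have h1 : ∑ k ∈ Finset.range (n + 1), p.coeff k • ((S.C * S.A ^ k) *ᵥ z t) = 0 := by
      have h2 := congrArg (fun X => (S.C * X) *ᵥ z t) S.A.aeval_self_charpoly
      simp only [Polynomial.aeval_eq_sum_range, Matrix.mul_sum, Matrix.sum_mulVec,
        Matrix.mul_smul, Matrix.smul_mulVec, Matrix.mul_zero, Matrix.zero_mulVec] at h2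
      rwa [show S.A.charpoly.natDegree = n from hp] at h2
    have h3 : ∑ k ∈ Finset.range (n + 1), p.coeff k • ∑ j ∈ Finset.range k,
        (S.C * S.A ^ (k - (j + 1)) * S.B) *ᵥ
          (fun μ => (Polynomial.derivative^[j] (P μ)).eval t) = 0 := by
      have h4 := Finset.sum_eq_zero (s := Finset.range (n + 1)) fun k _ =>
        (congrArg (p.coeff k • ·) (S.iteratedDeriv_output_eq_zero isOpen_Ioo hz' h0 k t ht)).trans
          (smul_zero (p.coeff k))
      simp only [smul_add, Finset.sum_add_distrib, h1, zero_add] at h4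
      exact h4
    have h5 := congrFun h3 α
    simp only [Finset.sum_apply, Pi.smul_apply, Matrix.mulVec, dotProduct, smul_eq_mul,
      Finset.mul_sum, Pi.zero_apply] at h5
    simpa [Q, Polynomial.IsRoot, Polynomial.eval_finsetSum, mul_assoc] using h5
  -- At derivative order `j₀`, the index `k = n` carries `C A ^ r B`, while each smaller `k > j₀`
  -- carries an earlier Markov parameter, zero by induction.
  let j₀ := n - (r + 1)
  have hMd : M ≤ d μ₀ := Nat.le_mul_of_pos_left M (Nat.succ_pos _)
  let e := d μ₀ - j₀
  have hej : e + j₀ = d μ₀ := by omega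
  -- The exponents `d μ` are at least `M ≥ n` apart and fewer than `n` derivatives occur, so the
  -- degree `e` arises from `(j₀, μ₀)` alone.
  have hcoeff : ∀ j < n, ∀ μ, (j, μ) ≠ (j₀, μ₀) → e + j ≠ d μ := by
    intro j hj μ hne he
    apply hne
    have hμ : (μ : ℕ) = μ₀ := by
      rcases lt_trichotomy (μ : ℕ) μ₀ with h | h | h
      · have : d μ + M ≤ d μ₀ := by
          simp only [d]
          calc ((μ : ℕ) + 1) * M + M = (μ + 1 + 1) * M := by ring
            _ ≤ _ := Nat.mul_le_mul_right M (by omega)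
        omega
      · exact h
      · have : d μ₀ + M ≤ d μ := by
          simp only [d]
          calc ((μ₀ : ℕ) + 1) * M + M = (μ₀ + 1 + 1) * M := by ring
            _ ≤ _ := Nat.mul_le_mul_right M (by omega)
        omega
    have hμ' : μ = μ₀ := Fin.ext hμ
    subst hμ'
    have : j = j₀ := by omega
    rw [this]
  have hterm : ∀ k ≤ n, ∀ j < k, ∀ μ, (k, j, μ) ≠ (n, j₀, μ₀) →
      (Polynomial.C (p.coeff k * (S.C * S.A ^ (k - (j + 1)) * S.B) α μ) *
        Polynomial.derivative^[j] (P μ)).coeff e = 0 := by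
    intro k hk j hj μ hne
    rw [Polynomial.coeff_C_mul, Polynomial.coeff_iterate_derivative, Polynomial.coeff_X_pow]
    by_cases h : (j, μ) = (j₀, μ₀)
    · obtain ⟨rfl, rfl⟩ := Prod.mk.inj h
      have hkn : k ≠ n := fun h => hne (by rw [h])
      rw [ih (k - (j₀ + 1)) (by omega) (by omega)]
      simp
    · rw [if_neg (hcoeff j (by omega) μ h)]
      simp
  have hc := congrArg (fun q => Polynomial.coeff q e) hQ
  simp only [Q, Polynomial.finsetSum_coeff, Polynomial.coeff_zero] at hc
  rw [Finset.sum_eq_single n, Finset.sum_eq_single j₀, Finset.sum_eq_single μ₀] at hc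
  · rw [Polynomial.coeff_C_mul, Polynomial.coeff_iterate_derivative, Polynomial.coeff_X_pow,
      if_pos hej, show n - (j₀ + 1) = r by omega, ← hp,
      show p.coeff p.natDegree = 1 from S.A.charpoly_monic] at hc
    have hpos : ((e + j₀).descFactorial j₀ : ℝ) ≠ 0 :=
      Nat.cast_ne_zero.2 (Nat.pos_iff_ne_zero.1 (Nat.descFactorial_pos.2 (by omega)))
    simpa [hpos] using hc
  · exact fun μ _ hμ => hterm n le_rfl j₀ (by omega) μ (by simp [hμ])
  · simp
  · exact fun j hj hne => Finset.sum_eq_zero fun μ _ =>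
      hterm n le_rfl j (Finset.mem_range.1 hj) μ (by simp [hne])
  · exact fun h => absurd (Finset.mem_range.2 (by omega)) h
  · exact fun k hk hne => Finset.sum_eq_zero fun j hj => Finset.sum_eq_zero fun μ _ =>
      hterm k (Nat.lt_succ_iff.1 (Finset.mem_range.1 hk)) j (Finset.mem_range.1 hj) μ
        (by simp [hne])
  · simp

end LinearControlSystem

/-! ### Time bases and location observability -/

theorem HybridTimeBasis.exists_interval_of_ne (τ : HybridTimeBasis) {t : ℝ} (h0 : τ.t 0 ≤ t)
    (ht : ∀ j : ℕ, (j : ℕ∞) < τ.L → t ≠ τ.t j) :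
    ∃ j : ℕ, (j : ℕ∞) < τ.L ∧ τ.t j < t ∧ Icc (τ.t j) t ⊆ τ.interval j := by
  have hfin := τ.nonZeno t
  -- The non-Zeno condition provides a last index `j` with switching time at most `t`.
  obtain ⟨j, ⟨hj, hjt⟩, hmax⟩ :=
    hfin.exists_maximal ⟨0, by simpa using τ.L_pos, h0⟩
  refine ⟨j, hj, lt_of_le_of_ne hjt (ht j hj).symm, fun s hs => ⟨hs.1, fun hj' => ?_⟩⟩
  by_contra hle
  exact Nat.not_succ_le_self j (hmax ⟨hj', (not_lt.1 hle).trans hs.2⟩ (Nat.le_succ j))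

namespace GLSwSystem

variable {N m l : ℕ} (H : GLSwSystem N m l)

/-- Turns (T) into the existence of a nonzero Markov parameter of the augmented system below its
state dimension. -/
theorem augmented_markov (i h : Fin N) (k : ℕ) :
    (H.augmented i h).C * (H.augmented i h).A ^ k * (H.augmented i h).B =
      (H.S i).C * (H.S i).A ^ k * (H.S i).B - (H.S h).C * (H.S h).A ^ k * (H.S h).B := by
  simp only [augmented, Matrix.fromBlocks_diagonal_pow, Matrix.fromCols_mul_fromBlocks,
    Matrix.fromCols_mul_fromRows, Matrix.mul_zero, add_zero, zero_add, Matrix.neg_mul,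
    sub_eq_add_neg]

theorem augmented_output (i h : Fin N) (x : Fin (H.n i) → ℝ) (x' : Fin (H.n h) → ℝ) :
    (H.augmented i h).C *ᵥ Sum.elim x x' = (H.S i).C *ᵥ x - (H.S h).C *ᵥ x' := by
  rw [augmented, Matrix.fromCols_mulVec, Sum.elim_comp_inl, Sum.elim_comp_inr, Matrix.neg_mulVec,
    sub_eq_add_neg]

theorem hasDerivAt_augmented {i h : Fin N} {x : ℝ → Fin (H.n i) → ℝ} {x' : ℝ → Fin (H.n h) → ℝ}
    {w : Fin m → ℝ} {t : ℝ} (hx : HasDerivAt x ((H.S i).A *ᵥ x t + (H.S i).B *ᵥ w) t)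
    (hx' : HasDerivAt x' ((H.S h).A *ᵥ x' t + (H.S h).B *ᵥ w) t) :
    HasDerivAt (fun s => Sum.elim (x s) (x' s))
      ((H.augmented i h).A *ᵥ Sum.elim (x t) (x' t) + (H.augmented i h).B *ᵥ w) t := by
  rw [augmented, Matrix.fromBlocks_mulVec, Matrix.fromRows_mulVec, hasDerivAt_pi]
  rintro (j | j)
  · simpa using hasDerivAt_pi.1 hx j
  · simpa using hasDerivAt_pi.1 hx' j

variable {H}

/-- Executions under a common input in `U*` with equal outputs on an interval on which both
locations are constant have equal locations there. -/
theorem eq_of_output_eqOn {u : ℝ → Fin m → ℝ} (hu : u ∈ H.UStar) {i h : Fin N} {a b : ℝ}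
    (hab : a < b) {x : ℝ → Fin (H.n i) → ℝ} {x' : ℝ → Fin (H.n h) → ℝ}
    (hx : ∀ t ∈ Ioo a b, ContinuousAt u t →
      HasDerivAt x ((H.S i).A *ᵥ x t + (H.S i).B *ᵥ u t) t)
    (hx' : ∀ t ∈ Ioo a b, ContinuousAt u t →
      HasDerivAt x' ((H.S h).A *ᵥ x' t + (H.S h).B *ᵥ u t) t)
    (hy : ∀ t ∈ Ioo a b, (H.S i).C *ᵥ x t = (H.S h).C *ᵥ x' t) : i = h := by
  by_contra hne
  obtain ⟨s, w, hw, c, hsc, heq⟩ := (H.augmented i h).exists_nullingInputs_eqOn hu.1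
    (z := fun t => Sum.elim (x t) (x' t)) hab
    (fun t ht hc => H.hasDerivAt_augmented (hx t ht hc) (hx' t ht hc))
    (fun t ht => by rw [augmented_output, hy t ht, sub_self])
  exact hu.2 i h hne s w hw ⟨s, c, le_rfl, hsc, heq⟩

theorem locationObservableFor_of_mem_UStar (hN : 0 < N) (t₀ : ℝ) {u : ℝ → Fin m → ℝ}
    (hu : u ∈ H.UStar) : H.LocationObservableFor t₀ u := by
  classical
  let P : (t : ℝ) → (Icc t₀ t → Fin l → ℝ) → H.Execution → Prop := fun t Y χ =>
    χ.τ.t 0 = t₀ ∧ χ.u = u ∧ (fun s : Icc t₀ t => χ.y s) = Y ∧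
      ∀ j : ℕ, (j : ℕ∞) < χ.τ.L → t ≠ χ.τ.t j
  -- The observer returns the location of any execution compatible with the data, and an arbitrary
  -- one if there is none. Any bound beyond `t₀` would serve in place of `t₀ + 1`.
  refine ⟨fun t Y _ => if hP : ∃ χ, P t Y χ then (hP.choose.ξ t).1 else ⟨0, hN⟩,
    fun ρ _ => ⟨t₀ + 1, lt_add_one t₀, fun χ h0 hχu _ t ht hns => ?_⟩⟩
  have hP : ∃ χ', P t (fun s => χ.y s) χ' := ⟨χ, h0, hχu, rfl, hns⟩
  beta_reduce
  rw [dif_pos hP]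
  obtain ⟨h0', hχu', hY, hns'⟩ := hP.choose_spec
  set χ' := hP.choose
  have ht₀ : t₀ < t := (lt_add_one t₀).trans_le ht
  obtain ⟨j, hj, hjt, hI⟩ := χ.τ.exists_interval_of_ne (h0.trans_le ht₀.le) hns
  obtain ⟨j', hj', hjt', hI'⟩ := χ'.τ.exists_interval_of_ne (h0'.trans_le ht₀.le) hns'
  rw [χ.state_eq j hj t (hI (right_mem_Icc.2 hjt.le)),
    χ'.state_eq j' hj' t (hI' (right_mem_Icc.2 hjt'.le))]
  -- On `(a, t)` neither execution switches, and the outputs agree because the interval lies in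
  -- `[t₀, t]`.
  let a := max t₀ (max (χ.τ.t j) (χ'.τ.t j'))
  have hat : a < t := max_lt ht₀ (max_lt hjt hjt')
  have hsub : Ioo a t ⊆ χ.τ.interval j := fun s hs =>
    hI ⟨((le_max_left _ _).trans (le_max_right _ _)).trans hs.1.le, hs.2.le⟩
  have hsub' : Ioo a t ⊆ χ'.τ.interval j' := fun s hs =>
    hI' ⟨((le_max_right _ _).trans (le_max_right _ _)).trans hs.1.le, hs.2.le⟩
  refine eq_of_output_eqOn hu hat (x := χ'.arc j') (x' := χ.arc j) (fun s hs hc => ?_)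
    (fun s hs hc => ?_) fun s hs => ?_
  · have := (χ'.flow j' hj').2 s (interior_maximal hsub' isOpen_Ioo hs) (hχu' ▸ hc)
    rwa [hχu'] at this
  · have := (χ.flow j hj).2 s (interior_maximal hsub isOpen_Ioo hs) (hχu ▸ hc)
    rwa [hχu] at this
  · rw [← χ.output_eq j hj s (hsub hs), ← χ'.output_eq j' hj' s (hsub' hs)]
    exact congrFun hY ⟨s, (le_max_left _ _).trans hs.1.le, hs.2.le⟩

/-- The input with coordinates `t ^ ((μ + 1) M)`, where `M` bounds the dimensions of the augmented
systems, belongs to `U*`. -/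
theorem UStar_nonempty_of_condT (hT : H.CondT) : H.UStar.Nonempty := by
  let M := ∑ i, H.n i + ∑ i, H.n i
  have hM : ∀ i h, Fintype.card (Fin (H.n i) ⊕ Fin (H.n h)) ≤ M := fun i h => by
    rw [Fintype.card_sum, Fintype.card_fin, Fintype.card_fin]
    exact add_le_add
      (Finset.single_le_sum (f := H.n) (fun _ _ => Nat.zero_le _) (Finset.mem_univ i))
      (Finset.single_le_sum (f := H.n) (fun _ _ => Nat.zero_le _) (Finset.mem_univ h))
  let u : ℝ → Fin m → ℝ := fun t μ => t ^ (((μ : ℕ) + 1) * M)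
  have hu : Continuous u := continuous_pi fun μ => continuous_pow _
  refine ⟨u, .of_continuous hu, ?_⟩
  rintro i h hne s w ⟨hw, K, z, v, hK, hz, hs, hv⟩ ⟨a, b, hsa, hab, heq⟩
  obtain ⟨k, hk, hkne⟩ := hT i h hne
  have hzV : ∀ t ∈ Ioo a b, z t ∈ (H.augmented i h).maxControlledInvariant := fun t ht =>
    (H.augmented i h).mem_maxControlledInvariant_of_feedback hw hK hz hs hv (hsa.trans ht.1.le)
  have hzero := (H.augmented i h).markov_eq_zero_of_monomial_input (hM i h) hab (z := z)
    (fun t ht => by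
      -- Inside `(a, b)` the input `w` inherits the continuity of `u`, so the state equation holds
      -- at every instant there.
      have hev : u =ᶠ[𝓝 t] w := (isOpen_Ioo.eventually_mem ht).mono fun r hr =>
        heq r (Ioo_subset_Icc_self hr)
      have := hz.2 t (by rw [interior_Ici]; exact hsa.trans_lt ht.1)
        (hu.continuousAt.congr hev)
      rwa [← heq t (Ioo_subset_Icc_self ht)] at this)
    (fun t ht => (H.augmented i h).isGreatest_maxControlledInvariant.1.2 (hzV t ht)) k
    (by simpa using hk)
  rw [augmented_markov, sub_eq_zero] at hzero
  exact hkne hzero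

/-- The execution without switching, from the zero state at location `i`. -/
noncomputable def zeroStateExecution (H : GLSwSystem N m l) (t₀ : ℝ) {u : ℝ → Fin m → ℝ}
    (hu : PiecewiseContinuous u) (i : Fin N) : H.Execution where
  τ :=
    { L := 1
      L_pos := one_pos
      t := fun j => t₀ + j
      lt_succ := fun j _ => by push_cast; linarith
      nonZeno := fun b => (finite_singleton 0).subset fun j hj => by
        simpa using hj.1 }
  u := u
  ξ := fun t =>
    ⟨i, forcedResponse (H.S i).A.mulVecContinuousLin (fun s => (H.S i).B *ᵥ u s) t₀ t⟩
  y := fun t => (H.S i).C *ᵥ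
    forcedResponse (H.S i).A.mulVecContinuousLin (fun s => (H.S i).B *ᵥ u s) t₀ t
  loc := fun _ => i
  arc := fun _ => forcedResponse (H.S i).A.mulVecContinuousLin (fun s => (H.S i).B *ᵥ u s) t₀
  input_pc := hu
  output_pc := .of_continuous ((H.S i).C.mulVecContinuousLin.continuous.comp
    (continuous_forcedResponse _ t₀ (hu.clm_apply
      (Φ := fun _ => (H.S i).B.mulVecContinuousLin) continuous_const)))
  state_eq := fun _ _ _ _ => rfl
  flow := fun _ _ => (H.S i).isTrajectory_forcedResponse hu t₀ _
  output_eq := fun _ _ _ _ => rfl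
  jump := fun j hj => by simp at hj

theorem contNorm_zeroStateExecution (H : GLSwSystem N m l) (t₀ : ℝ) {u : ℝ → Fin m → ℝ}
    (hu : PiecewiseContinuous u) (i : Fin N) :
    H.contNorm ((H.zeroStateExecution t₀ hu i).ξ t₀) = 0 := by
  have h : (H.zeroStateExecution t₀ hu i).ξ t₀ = ⟨i, 0⟩ := by
    simp only [zeroStateExecution, forcedResponse_self]
  rw [h, contNorm]
  exact norm_zero

theorem condT_of_locationObservable {t₀ : ℝ} (hobs : H.LocationObservable t₀) : H.CondT := by
  obtain ⟨u, hu, qhat, hq⟩ := hobs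
  intro i h hne
  by_contra! hall
  have hmarkov : ∀ k, (H.S i).C * (H.S i).A ^ k * (H.S i).B =
      (H.S h).C * (H.S h).A ^ k * (H.S h).B := fun k => by
    rw [← sub_eq_zero, ← augmented_markov]
    refine (H.augmented i h).markov_eq_zero_of_lt_card (fun k hk => ?_) k
    rw [augmented_markov, sub_eq_zero]
    exact hall k (by simpa using hk)
  obtain ⟨T, hT, hobs⟩ := hq 1 one_pos
  -- The zero-state executions are admissible for every norm bound; for the pair `i`, `h` they feed
  -- the same data to `qhat`, which would have to return both locations.
  have key : ∀ i, qhat T (fun s => (H.zeroStateExecution t₀ hu i).y s) (fun s => u s) = i :=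
    fun i => hobs (H.zeroStateExecution t₀ hu i) (by simp [zeroStateExecution]) rfl
      ((H.contNorm_zeroStateExecution t₀ hu i).trans_le zero_le_one) T le_rfl fun j hj => by
        have hj0 : j = 0 := by simpa [zeroStateExecution] using hj
        subst hj0
        simpa [zeroStateExecution] using hT.ne'
  apply hne
  rw [← key i, ← key h]
  congr 1
  funext s
  exact (H.S i).output_forcedResponse_eq (H.S h) hmarkov hu t₀ s

end GLSwSystem

theorem mainTheorem1 {N m l : ℕ} (hN : 0 < N) (H : GLSwSystem N m l) (t₀ : ℝ) :
    (H.LocationObservable t₀ ↔ H.CondT) ∧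
      (H.CondT → H.UStar.Nonempty) ∧
      ∀ u ∈ H.UStar, H.LocationObservableFor t₀ u := by
  refine ⟨⟨GLSwSystem.condT_of_locationObservable, fun hT => ?_⟩,
    GLSwSystem.UStar_nonempty_of_condT,
    fun u hu => GLSwSystem.locationObservableFor_of_mem_UStar hN t₀ hu⟩
  obtain ⟨u, hu⟩ := GLSwSystem.UStar_nonempty_of_condT hT
  exact ⟨u, hu.1, GLSwSystem.locationObservableFor_of_mem_UStar hN t₀ hu⟩
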